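/- Let $R$ be an irreducible reduced crystallographic root system (the roots of a finite-dimensional complex simple Lie algebra) with simple roots $\{\alpha_i\}_{i\in I}$, let $Q^+$ be the $\mathbb Z_{\ge 0}$-span of the simple roots, and let $R^+=R\cap Q^+$. Let $W$ be the Weyl group, with simple reflections $s_i$, and let $A=(a_{ij})_{i,j\in I}$ be the Cartan matrix, normalized by $s_i(\alpha_j)=\alpha_j-a_{ij}\alpha_i$. Let $(d_i)_{i\in I}$ be the relatively prime positive integers such that the matrix $(d_ia_{ij})$ is symmetric. Let $q\in\mathbb C^\times$ not be a root of unity, and put $q_i=q^{d_i}$. Let $\mathcal P$ be the group, under coordinatewise multiplication, of $I$-tuples $\varpi=(\varpi_i)_{i\in I}$ of rational functions $\varpi_i\in\mathbb C(u)$ that are quotients of polynomials with constant term one. For $i\in I$ and $a\in\mathbb C^\times$ let $\pi_{i,a}\in\mathcal P$ have $i$-th coordinate $1-au$ and all other coordinates $1$. For $i\in I$ the generator $\tilde T_i$ of the braid group of $W$ acts on $\mathcal P$ by $$(\tilde T_i\varpi)_i=\frac1{\varpi_i(q_i^2u)},\qquad (\tilde T_i\varpi)_j=\begin{cases}\varpi_j(u)&\text{if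 } a_{ji}=0,\\ \varpi_j(u)\,\varpi_i(q_iu)&\text{if } a_{ji}=-1,\\ \varpi_j(u)\,\varpi_i(q^3u)\,\varpi_i(qu)&\text{if } a_{ji}=-2,\\ \varpi_j(u)\,\varpi_i(q^5u)\,\varpi_i(q^3u)\,\varpi_i(qu)&\text{if } a_{ji}=-3\end{cases}\qquad(j\neq i).$$ For $w\in W$ put $\tilde T_w=\tilde T_{i_1}\cdots\tilde T_{i_k}$, where $w=s_{i_1}\cdots s_{i_k}$ is a reduced expression. Define the $\ell$-roots $\boldsymbol\alpha_{i,a}=(\tilde T_i\pi_{i,a})^{-1}\pi_{i,a}$, and let $\mathcal Q^+\subset\mathcal P$ be the monoid generated by all $\boldsymbol\alpha_{i,a}$ with $i\in I$, $a\in\mathbb C^\times$. Let $w\in W$ and $i\in I$ be such that $w\alpha_i\in R^+$. Then, for every $a\in\mathbb C^\times$ and every reduced expression of $w$ used to form $\tilde T_w$, one has $\tilde T_w\boldsymbol\alpha_{i,a}\in\mathcal Q^+$. -/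

import Mathlib

open Polynomial

noncomputable section

namespace EllRoot

/-! ### Rational functions in `u` and the `ℓ`-weight lattice -/

theorem nonZeroDivisors_le_comap_scale (c : ℂˣ) :
    nonZeroDivisors ℂ[X] ≤
      (nonZeroDivisors ℂ[X]).comap (aeval (C (c : ℂ) * X) : ℂ[X] →ₐ[ℂ] ℂ[X]) := by
  intro p hp
  rw [Submonoid.mem_comap, mem_nonZeroDivisors_iff_ne_zero]
  have hp0 : p ≠ 0 := nonZeroDivisors.ne_zero hp
  have hdeg : (C (c : ℂ) * X : ℂ[X]).natDegree = 1 := natDegree_C_mul_X _ c.ne_zero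
  intro h
  have h2 : p.comp (C (c : ℂ) * X) = 0 := by
    simpa [comp_eq_aeval] using h
  rw [comp_eq_zero_iff] at h2
  rcases h2 with h2 | ⟨_, h2⟩
  · exact hp0 h2
  · rw [h2, natDegree_C] at hdeg
    exact absurd hdeg (by norm_num)

/-- The substitution `f(u) ↦ f(c u)` on the field `ℂ(u)`, for `c ∈ ℂˣ`. -/
def substRatFunc (c : ℂˣ) : RatFunc ℂ →ₐ[ℂ] RatFunc ℂ :=
  RatFunc.mapAlgHom (aeval (C (c : ℂ) * X) : ℂ[X] →ₐ[ℂ] ℂ[X]) (nonZeroDivisors_le_comap_scale c)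

theorem substRatFunc_algebraMap (c : ℂˣ) (p : ℂ[X]) :
    substRatFunc c (algebraMap ℂ[X] (RatFunc ℂ) p) =
      algebraMap ℂ[X] (RatFunc ℂ) (p.comp (C (c : ℂ) * X)) := by
  have h := RatFunc.map_apply_div (aeval (C (c : ℂ) * X) : ℂ[X] →ₐ[ℂ] ℂ[X])
    (nonZeroDivisors_le_comap_scale c) p 1
  rw [map_one, map_one, map_one, div_one, div_one, ← comp_eq_aeval] at h
  exact h

/-- The group of quotients `p / r` of polynomials `p, r ∈ ℂ[u]` with constant term one, as a
subgroup of `ℂ(u)ˣ`. -/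
def unitaryRatFunc : Subgroup (RatFunc ℂ)ˣ where
  carrier := {f | ∃ p r : ℂ[X], p.coeff 0 = 1 ∧ r.coeff 0 = 1 ∧
    (f : RatFunc ℂ) = algebraMap ℂ[X] (RatFunc ℂ) p / algebraMap ℂ[X] (RatFunc ℂ) r}
  one_mem' := ⟨1, 1, by simp, by simp, by simp⟩
  mul_mem' := by
    rintro f g ⟨p, r, hp, hr, hf⟩ ⟨p', r', hp', hr', hg⟩
    refine ⟨p * p', r * r', ?_, ?_, ?_⟩
    · rw [mul_coeff_zero, hp, hp', one_mul]
    · rw [mul_coeff_zero, hr, hr', one_mul]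
    · rw [Units.val_mul, hf, hg, map_mul, map_mul, div_mul_div_comm]
  inv_mem' := by
    rintro f ⟨p, r, hp, hr, hf⟩
    refine ⟨r, p, hr, hp, ?_⟩
    rw [Units.val_inv_eq_inv_val, hf, inv_div]

/-- The substitution `f(u) ↦ f(c u)` on quotients of polynomials with constant term one. -/
def subst (c : ℂˣ) : unitaryRatFunc →* unitaryRatFunc :=
  ((Units.map (substRatFunc c : RatFunc ℂ →* RatFunc ℂ)).comp unitaryRatFunc.subtype).codRestrict
    unitaryRatFunc (by
      rintro ⟨f, p, r, hp, hr, hf⟩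
      refine ⟨p.comp (C (c : ℂ) * X), r.comp (C (c : ℂ) * X), ?_, ?_, ?_⟩
      · simpa [coeff_zero_eq_eval_zero] using hp
      · simpa [coeff_zero_eq_eval_zero] using hr
      · change substRatFunc c (f : RatFunc ℂ) = _
        rw [hf, map_div₀, substRatFunc_algebraMap, substRatFunc_algebraMap])

/-- The `ℓ`-weight lattice `𝒫`: the group, under coordinatewise multiplication, of `I`-tuples of
quotients of polynomials with constant term one. For finite `I` this is the group of fractions of
the monoid `𝒫⁺` of `I`-tuples of polynomials with constant term one. -/
abbrev LWeight (I : Type*) : Type _ := I → unitaryRatFunc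

/-- The polynomial `1 - a u`, as an element of `unitaryRatFunc`. -/
def oneSub (a : ℂˣ) : unitaryRatFunc :=
  ⟨Units.mk0 (algebraMap ℂ[X] (RatFunc ℂ) (1 - C (a : ℂ) * X)) (by
      intro h
      rw [map_eq_zero_iff _ (RatFunc.algebraMap_injective ℂ)] at h
      have := congrArg (fun p : ℂ[X] => p.coeff 0) h
      simp at this),
    ⟨1 - C (a : ℂ) * X, 1, by simp, by simp, by simp⟩⟩

section Operators

variable {I : Type*} [DecidableEq I]

/-- The fundamental `ℓ`-weight `π_{i,a}`: its `i`-th coordinate is `1 - a u`, all others are `1`. -/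
def fundWeight (i : I) (a : ℂˣ) : LWeight I := Pi.mulSingle i (oneSub a)

/-- The factor by which the `j`-th coordinate is multiplied under `T̃_i` for `j ≠ i`, as a function
of `c = a_{ji}`, of `q_i`, and of the `i`-th coordinate `f`: it is `1` if `c = 0`, `f(q_i u)` if
`c = -1`, `f(q³u) f(qu)` if `c = -2`, and `f(q⁵u) f(q³u) f(qu)` if `c = -3`. (An off-diagonal entry
of a Cartan matrix of finite type takes no other value.) -/
def bondFactor (q qi : ℂˣ) (c : ℤ) : unitaryRatFunc →* unitaryRatFunc :=
  if c = -1 then subst qi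
  else if c = -2 then subst (q ^ 3) * subst q
  else if c = -3 then subst (q ^ 5) * subst (q ^ 3) * subst q
  else 1

/-- The operator `T̃_i` on the `ℓ`-weight lattice by which the `i`-th generator of the braid group
acts; here `q_i = q ^ d i`. -/
def braidOp (A : Matrix I I ℤ) (d : I → ℕ) (q : ℂˣ) (i : I) : LWeight I →* LWeight I where
  toFun ϖ j :=
    if j = i then (subst ((q ^ d i) ^ 2) (ϖ i))⁻¹
    else ϖ j * bondFactor q (q ^ d i) (A j i) (ϖ i)
  map_one' := by
    funext j
    by_cases h : j = i <;> simp [h]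
  map_mul' x y := by
    funext j
    by_cases h : j = i
    · simp [h, mul_comm]
    · simp [h, mul_mul_mul_comm]

/-- The operator `T̃_{i₁} ∘ ⋯ ∘ T̃_{iₖ}` on the `ℓ`-weight lattice. -/
def braidWordOp (A : Matrix I I ℤ) (d : I → ℕ) (q : ℂˣ) : List I → (LWeight I →* LWeight I)
  | [] => MonoidHom.id _
  | i :: l => (braidOp A d q i).comp (braidWordOp A d q l)

theorem braidWordOp_nil_apply (A : Matrix I I ℤ) (d : I → ℕ) (q : ℂˣ) (ϖ : LWeight I) :
    braidWordOp A d q [] ϖ = ϖ := rfl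

theorem braidWordOp_cons_apply (A : Matrix I I ℤ) (d : I → ℕ) (q : ℂˣ) (i : I) (l : List I)
    (ϖ : LWeight I) :
    braidWordOp A d q (i :: l) ϖ = braidOp A d q i (braidWordOp A d q l ϖ) := rfl

/-- The `ℓ`-root `α_{i,a} = (T̃_i π_{i,a})⁻¹ π_{i,a}`. -/
def lRoot (A : Matrix I I ℤ) (d : I → ℕ) (q : ℂˣ) (i : I) (a : ℂˣ) : LWeight I :=
  (braidOp A d q i (fundWeight i a))⁻¹ * fundWeight i a

/-- The monoid `𝒬⁺` generated by all the `ℓ`-roots `α_{i,a}`, `i ∈ I`, `a ∈ ℂˣ`. -/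
def lRootMonoid (A : Matrix I I ℤ) (d : I → ℕ) (q : ℂˣ) : Submonoid (LWeight I) :=
  Submonoid.closure {x | ∃ i a, x = lRoot A d q i a}

end Operators

/-! ### The root system and its Weyl group -/

section RootSystem

variable {ι k M N : Type*} [Field k] [AddCommGroup M] [Module k M]
  [AddCommGroup N] [Module k N] {P : RootPairing ι k M N}

/-- The Cartan matrix `A = (a_{ij})` in the convention `s_i(α_j) = α_j - a_{ij} α_i`, that is
`a_{ij} = ⟨α_j, α_i^∨⟩`. Mathlib's `RootPairing.Base.cartanMatrix` uses the transposed convention. -/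
def cartan [P.IsCrystallographic] (b : P.Base) : Matrix b.support b.support ℤ :=
  b.cartanMatrix.transpose

theorem reflection_simple [P.IsCrystallographic] (b : P.Base) (i j : b.support) :
    P.reflection i (P.root j) = P.root j - cartan b i j • P.root i :=
  P.reflection_apply_root' ℤ

/-- The set `R⁺ = R ∩ Q⁺` of positive roots. -/
def positiveRoots (b : P.Base) : Set M :=
  {x | x ∈ Set.range P.root ∧ x ∈ AddSubmonoid.closure (P.root '' b.support)}

/-- The element `s_{i₁} ⋯ s_{iₖ}` of the Weyl group. -/
def weylWord (b : P.Base) (l : List b.support) : P.weylGroup :=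
  (l.map fun i => RootPairing.weylGroup.ofIdx P (i : ι)).prod

/-- The word `(i₁, …, iₖ)` is a reduced expression of `w`: `s_{i₁} ⋯ s_{iₖ} = w`, and no shorter
word has this product. -/
def IsReducedExpr (b : P.Base) (w : P.weylGroup) (l : List b.support) : Prop :=
  weylWord b l = w ∧ ∀ l' : List b.support, weylWord b l' = w → l.length ≤ l'.length

end RootSystem

end EllRoot

end

/-!
Written additively, the `ℓ`-weight lattice is a module over the group ring of `ℂˣ`, and `T̃_i` is
the pseudo-reflection `v ↦ v - x_i (φ_i v)`, where the pairings of the `φ_i` with the `x_j` form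
a deformation of the Cartan matrix by `t = [q]`; the simple reflections are the same at `t = 1`.
One shows by induction on the length of `w` that `T̃_w x_i` is positive if `w α_i` is. If `w`
ends in `s_j`, write `w = v u` with `v` minimal in its coset modulo `⟨s_i, s_j⟩` and `u`
alternating; by Matsumoto's theorem `T̃_w = T̃_v T̃_u`. Since `T̃_v` maps `x_i` and `x_j` to
positive elements, it is enough that `T̃_u x_i` is a combination of `x_i` and `x_j` with
coefficients in `ℕ[t]`: a finite computation in rank two.
-/

noncomputable section

namespace EllRoot

open CoxeterSystem (alternatingWord alternatingWord_succ alternatingWord_succ'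
  length_alternatingWord)

section Words

variable {I E : Type*} [Monoid E]

/-- The product in `E` of the letters `f i` of a word. -/
def wordProd (f : I → E) (l : List I) : E := (l.map f).prod

@[simp] theorem wordProd_nil (f : I → E) : wordProd f [] = 1 := rfl

@[simp] theorem wordProd_cons (f : I → E) (i : I) (l : List I) :
    wordProd f (i :: l) = f i * wordProd f l := by
  simp [wordProd]

@[simp] theorem wordProd_append (f : I → E) (l l' : List I) :
    wordProd f (l ++ l') = wordProd f l * wordProd f l' := by
  simp [wordProd]

theorem map_wordProd {F : Type*} [Monoid F] (ρ : F →* E) (s : I → F) (l : List I) :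
    ρ (wordProd s l) = wordProd (ρ ∘ s) l := by
  simp [wordProd, map_list_prod]

/-- The word `l` is a reduced word for the letters `f i`: no shorter word has the same product. -/
def IsReducedWord (f : I → E) (l : List I) : Prop :=
  ∀ l', wordProd f l' = wordProd f l → l.length ≤ l'.length

variable {f : I → E}

theorem IsReducedWord.of_append_left {l l' : List I} (h : IsReducedWord f (l ++ l')) :
    IsReducedWord f l := by
  intro m hm
  simpa using h (m ++ l') (by simp [hm])

theorem IsReducedWord.of_wordProd_eq {l l' : List I} (h : IsReducedWord f l)
    (hprod : wordProd f l' = wordProd f l) (hlen : l'.length = l.length) :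
    IsReducedWord f l' :=
  fun m hm => hlen ▸ h m (hm.trans hprod)

/-- Elements `f i` of a monoid that satisfy the braid relations of the Coxeter matrix `M`, with a
predicate `P z i` that stands for `z αᵢ` being positive. Positivity is only required to propagate
along alternating words shorter than the braid relation; as in Mathlib, `M i j = 0` encodes the
absence of a relation. -/
structure IsPositiveBraidFamily (M : CoxeterMatrix I) (f : I → E) (P : E → I → Prop) :
    Prop where
  pos_one : ∀ i, P 1 i
  braid : ∀ i j, wordProd f (alternatingWord i j (M i j)) =
    wordProd f (alternatingWord j i (M i j))
  pos_mul_alternating : ∀ i j k, (M i j ≠ 0 → k < M i j) → ∀ z, P z i → P z j →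
    P (z * wordProd f (alternatingWord i j k)) i

theorem IsPositiveBraidFamily.of_injective {F : Type*} [Monoid F] {M : CoxeterMatrix I}
    {P : E → I → Prop} {ρ : F →* E} (hρ : Function.Injective ρ) {s : I → F}
    (h : IsPositiveBraidFamily M (ρ ∘ s) P) :
    IsPositiveBraidFamily M s fun g i => P (ρ g) i where
  pos_one i := by simpa using h.pos_one i
  braid i j := hρ (by simpa [map_wordProd] using h.braid i j)
  pos_mul_alternating i j k hk z hi hj := by
    simpa [map_wordProd] using h.pos_mul_alternating i j k hk (ρ z) hi hj

end Words

/-- Involutions `s i` generating a reflection group, with a predicate `P g i` that stands for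
`g αᵢ` being a positive root. -/
structure IsReflectionSystem {I G : Type*} [Group G] (M : CoxeterMatrix I) (s : I → G)
    (P : G → I → Prop) : Prop extends IsPositiveBraidFamily M s P where
  mul_self : ∀ i, s i * s i = 1
  pos_mul_iff : ∀ g i, P (g * s i) i ↔ ¬ P g i
  exchange : ∀ g i j, P g j → ¬ P (s i * g) j → s i * g = g * s j

namespace IsReflectionSystem

variable {I G : Type*} [Group G] {M : CoxeterMatrix I} {s : I → G} {P : G → I → Prop}

theorem exists_word_of_not_pos (hs : IsReflectionSystem M s P) {l : List I} {j : I}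
    (h : ¬ P (wordProd s l) j) :
    ∃ l', l'.length + 1 = l.length ∧ wordProd s l' = wordProd s l * s j := by
  induction l with
  | nil => exact absurd (hs.pos_one j) h
  | cons i l ih =>
    by_cases hl : P (wordProd s l) j
    · have hexch := hs.exchange _ i j hl (by simpa using h)
      exact ⟨l, rfl, by simp [hexch, mul_assoc, hs.mul_self]⟩
    · obtain ⟨l', hlen, hprod⟩ := ih hl
      exact ⟨i :: l', by simpa using hlen, by simp [hprod, mul_assoc]⟩

theorem exists_isReducedWord_append_of_not_pos (hs : IsReflectionSystem M s P) {l : List I} {j : I}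
    (hl : IsReducedWord s l) (h : ¬ P (wordProd s l) j) :
    ∃ l', IsReducedWord s (l' ++ [j]) ∧ wordProd s (l' ++ [j]) = wordProd s l ∧
      l'.length + 1 = l.length := by
  obtain ⟨l', hlen, hl'⟩ := hs.exists_word_of_not_pos h
  have hprod : wordProd s (l' ++ [j]) = wordProd s l := by simp [hl', mul_assoc, hs.mul_self]
  exact ⟨l', hl.of_wordProd_eq hprod (by simpa using hlen), hprod, hlen⟩

theorem pos_of_isReducedWord_append (hs : IsReflectionSystem M s P) {l : List I} {j : I}
    (h : IsReducedWord s (l ++ [j])) : P (wordProd s l) j := by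
  by_contra hneg
  obtain ⟨l', hlen, hl'⟩ := hs.exists_word_of_not_pos hneg
  have hle := h l' (by simpa using hl')
  rw [List.length_append, List.length_singleton] at hle
  omega

theorem not_pos_of_isReducedWord_append (hs : IsReflectionSystem M s P) {l : List I} {j : I}
    (h : IsReducedWord s (l ++ [j])) : ¬ P (wordProd s (l ++ [j])) j := by
  simpa [hs.pos_mul_iff] using hs.pos_of_isReducedWord_append h

theorem not_pos_of_isReducedWord_append_alternatingWord (hs : IsReflectionSystem M s P)
    {v : List I} {i j : I} (hM : M i j ≠ 0)
    (h : IsReducedWord s (v ++ alternatingWord i j (M i j))) :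
    ¬ P (wordProd s (v ++ alternatingWord i j (M i j))) i := by
  have hprod : wordProd s (v ++ alternatingWord j i (M i j)) =
      wordProd s (v ++ alternatingWord i j (M i j)) := by simp [hs.braid i j]
  have hred := h.of_wordProd_eq hprod (by simp)
  obtain ⟨m, hm⟩ := Nat.exists_eq_succ_of_ne_zero hM
  rw [← hprod]
  rw [hm, alternatingWord_succ, List.concat_eq_append, ← List.append_assoc] at hred ⊢
  exact hs.not_pos_of_isReducedWord_append hred

/-- The element is written as `v u`, where `v` is minimal in its coset modulo the dihedral subgroup
generated by `s i` and `s j`, and `u` is an alternating product ending in the descent `j`. -/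
theorem exists_append_alternatingWord (hs : IsReflectionSystem M s P) (i : I) {j : I} {l : List I}
    (hl : IsReducedWord s l) (hj : ¬ P (wordProd s l) j) :
    ∃ v k, (M i j ≠ 0 → k < M i j) ∧ P (wordProd s v) i ∧ P (wordProd s v) j ∧
      wordProd s (v ++ alternatingWord i j (k + 1)) = wordProd s l ∧
      (v ++ alternatingWord i j (k + 1)).length = l.length := by
  induction hn : l.length generalizing i j l with
  | zero =>
    obtain rfl := List.length_eq_zero_iff.mp hn
    exact absurd (hs.pos_one j) hj
  | succ n ih =>
    obtain ⟨l', hred, hprod, hlen⟩ := hs.exists_isReducedWord_append_of_not_pos hl hj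
    have hl'j := hs.pos_of_isReducedWord_append hred
    by_cases hl'i : P (wordProd s l') i
    · exact ⟨l', 0, Nat.pos_of_ne_zero, hl'i, hl'j, by simpa [alternatingWord] using hprod,
        by simpa [hn] using hlen⟩
    obtain ⟨v, k, hk, hvj, hvi, hvprod, hvlen⟩ := ih j hred.of_append_left hl'i (by omega)
    have hvred := hred.of_append_left.of_wordProd_eq hvprod (by omega)
    refine ⟨v, k + 1, fun hM => ?_, hvi, hvj, ?_, ?_⟩
    · rw [M.symmetric i j] at hM ⊢
      refine lt_of_le_of_ne (hk hM) fun hkM => ?_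
      rw [hkM] at hvprod hvred
      exact hs.not_pos_of_isReducedWord_append_alternatingWord hM hvred (hvprod ▸ hl'j)
    · rw [alternatingWord_succ, List.concat_eq_append, ← List.append_assoc, ← hprod,
        wordProd_append, hvprod, wordProd_append]
    · simp only [List.length_append, length_alternatingWord] at *
      omega

theorem exists_append_longest_of_not_pos (hs : IsReflectionSystem M s P) {i j : I} {l : List I}
    (hl : IsReducedWord s l) (hi : ¬ P (wordProd s l) i) (hj : ¬ P (wordProd s l) j) :
    ∃ v, M i j ≠ 0 ∧ wordProd s (v ++ alternatingWord i j (M i j)) = wordProd s l ∧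
      (v ++ alternatingWord i j (M i j)).length = l.length := by
  obtain ⟨v, k, hk, hvi, hvj, hprod, hlen⟩ := hs.exists_append_alternatingWord i hl hj
  have hkM : k + 1 = M i j := by
    by_contra hkM
    apply hi
    rw [← hprod, wordProd_append]
    exact hs.pos_mul_alternating i j (k + 1) (fun hM => by have := hk hM; omega) _ hvi hvj
  exact ⟨v, by omega, hkM ▸ hprod, hkM ▸ hlen⟩

/-- **Matsumoto's theorem**. -/
theorem wordProd_eq_of_isReducedWord (hs : IsReflectionSystem M s P) {E : Type*} [Monoid E]
    {f : I → E} (hf : ∀ i j, wordProd f (alternatingWord i j (M i j)) =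
      wordProd f (alternatingWord j i (M i j)))
    {l l' : List I} (hl : IsReducedWord s l) (hl' : IsReducedWord s l')
    (h : wordProd s l = wordProd s l') : wordProd f l = wordProd f l' := by
  induction hn : l.length generalizing l l' with
  | zero =>
    obtain rfl := List.length_eq_zero_iff.mp hn
    obtain rfl := List.length_eq_zero_iff.mp (Nat.le_zero.mp (hl' [] h))
    rfl
  | succ n ih =>
    have hlen : l'.length = n + 1 := hn ▸ le_antisymm (hl' l h) (hl l' h.symm)
    have of_last : ∀ {a v : List I} (i j : I) {m : ℕ}, m ≠ 0 → IsReducedWord s (a ++ [j]) →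
        wordProd s (v ++ alternatingWord i j m) = wordProd s (a ++ [j]) →
        (v ++ alternatingWord i j m).length = (a ++ [j]).length → (a ++ [j]).length = n + 1 →
        wordProd f (a ++ [j]) = wordProd f (v ++ alternatingWord i j m) := by
      intro a v i j m hm ha hav hlen hn
      obtain ⟨k, rfl⟩ := Nat.exists_eq_succ_of_ne_zero hm
      rw [alternatingWord_succ, List.concat_eq_append, ← List.append_assoc] at hav hlen ⊢
      have hv := ha.of_wordProd_eq hav hlen
      rw [wordProd_append, wordProd_append f (v ++ _), ih ha.of_append_left hv.of_append_left
        (by simpa [← mul_assoc] using hav.symm) (by simpa using hn)]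
    obtain rfl | ⟨a, i, rfl⟩ := l.eq_nil_or_concat'
    · simp at hn
    obtain rfl | ⟨c, j, rfl⟩ := l'.eq_nil_or_concat'
    · simp at hlen
    obtain ⟨v, hM, hprod, hvlen⟩ := hs.exists_append_longest_of_not_pos hl'
      (h ▸ hs.not_pos_of_isReducedWord_append hl) (hs.not_pos_of_isReducedWord_append hl')
    calc wordProd f (a ++ [i])
        = wordProd f (v ++ alternatingWord j i (M i j)) :=
          of_last j i hM hl (by simpa [hs.braid i j] using hprod.trans h.symm)
            (by simp_all) hn
      _ = wordProd f (v ++ alternatingWord i j (M i j)) := by simp [hf i j]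
      _ = wordProd f (c ++ [j]) := (of_last i j hM hl' hprod hvlen hlen).symm

theorem pos_of_isReducedWord (hs : IsReflectionSystem M s P) {E : Type*} [Monoid E] {f : I → E}
    {Q : E → I → Prop} (hf : IsPositiveBraidFamily M f Q) {l : List I} (hl : IsReducedWord s l)
    {i : I} (hi : P (wordProd s l) i) : Q (wordProd f l) i := by
  induction hn : l.length using Nat.strong_induction_on generalizing l i with
  | _ n ih =>
    obtain rfl | ⟨c, j, rfl⟩ := l.eq_nil_or_concat'
    · exact hf.pos_one i
    obtain ⟨v, k, hk, hvi, hvj, hprod, hlen⟩ :=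
      hs.exists_append_alternatingWord i hl (hs.not_pos_of_isReducedWord_append hl)
    have hv := hl.of_wordProd_eq hprod hlen
    have hk' : M i j ≠ 0 → k + 1 < M i j := by
      refine fun hM => lt_of_le_of_ne (hk hM) fun hkM => ?_
      rw [hkM] at hv hprod
      exact hs.not_pos_of_isReducedWord_append_alternatingWord hM hv (hprod ▸ hi)
    have hvn : v.length < n := by
      rw [← hn, ← hlen, List.length_append, length_alternatingWord]
      omega
    rw [hs.wordProd_eq_of_isReducedWord hf.braid hl hv hprod.symm, wordProd_append]
    exact hf.pos_mul_alternating i j (k + 1) hk' _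
      (ih _ hvn hv.of_append_left hvi rfl) (ih _ hvn hv.of_append_left hvj rfl)

end IsReflectionSystem

section PseudoReflections

variable {R U V I : Type*} [CommRing R] [AddCommGroup U] [Module R U] [AddCommGroup V] [Module R V]

/-- The endomorphisms `v ↦ v - x i (φ i v)`. For `U = R` such a map is a reflection in the vector
`x i 1` (up to the value of `φ i (x i 1)`); a larger `U` treats a family of vectors at once. -/
def pseudoReflection (x : I → U →ₗ[R] V) (φ : I → V →ₗ[R] U) (i : I) : Module.End R V :=
  1 - x i ∘ₗ φ i

theorem pseudoReflection_apply (x : I → U →ₗ[R] V) (φ : I → V →ₗ[R] U) (i : I) (v : V) :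
    pseudoReflection x φ i v = v - x i (φ i v) := rfl

/-- Maps `x j`, `φ i` whose pairings are the scalars `C i j`. -/
def IsRealization (C : Matrix I I R) (x : I → U →ₗ[R] V) (φ : I → V →ₗ[R] U) : Prop :=
  ∀ i j u, φ i (x j u) = C i j • u

/-- The rank-two quantum Cartan matrix of type `A₂`, `B₂`, `G₂` for `n = 1, 2, 3`, where `i` is the
short root and `j` the long root. -/
structure IsQuantumBond (C : Matrix I I R) (t : R) (n : ℕ) (i j : I) : Prop where
  short : C i i = 1 + t ^ 2
  long : C j j = 1 + t ^ (2 * n)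
  short_long : C i j = -∑ l ∈ Finset.range n, t ^ (2 * l + 1)
  long_short : C j i = -t

/-- The alternating product `⋯ T_i T_j` with `k` factors maps the vectors `x i u` to
`p (x i u) + r (x j u)`. -/
def HasAlternatingCoeffs (x : I → U →ₗ[R] V) (φ : I → V →ₗ[R] U) (i j : I) (k : ℕ) (p r : R) :
    Prop :=
  ∀ u, wordProd (pseudoReflection x φ) (alternatingWord i j k) (x i u) = p • x i u + r • x j u

variable {C : Matrix I I R} {x : I → U →ₗ[R] V} {φ : I → V →ₗ[R] U} {i j : I} {t : R} {k : ℕ}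

theorem hasAlternatingCoeffs_zero : HasAlternatingCoeffs x φ i j 0 1 0 := fun u => by
  simp [alternatingWord]

theorem HasAlternatingCoeffs.succ_of_odd (h : IsRealization C x φ) {p r p' : R}
    (hpr : HasAlternatingCoeffs x φ i j k p r) (hk : Odd k)
    (hp' : p' = (1 - C i i) * p - C i j * r) : HasAlternatingCoeffs x φ i j (k + 1) p' r := by
  intro u
  rw [alternatingWord_succ', if_neg (Nat.not_even_iff_odd.mpr hk), wordProd_cons,
    Module.End.mul_apply, hpr u, pseudoReflection_apply]
  simp only [map_add, map_smul, h i i, h i j, hp']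
  module

theorem HasAlternatingCoeffs.succ_of_even (h : IsRealization C x φ) {p r r' : R}
    (hpr : HasAlternatingCoeffs x φ i j k p r) (hk : Even k)
    (hr' : r' = (1 - C j j) * r - C j i * p) : HasAlternatingCoeffs x φ i j (k + 1) p r' := by
  intro u
  rw [alternatingWord_succ', if_pos hk, wordProd_cons, Module.End.mul_apply, hpr u,
    pseudoReflection_apply]
  simp only [map_add, map_smul, h j i, h j j, hr']
  module

/-- The pair `T_i, T_j` satisfies the braid relation of length `m`, and its shorter alternating
products map `x i u` and `x j u` to combinations of both with coefficients in `Rpos`. The case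
`m = 0` encodes the absence of a relation. -/
structure IsPositiveDihedral (Rpos : Subsemiring R) (x : I → U →ₗ[R] V) (φ : I → V →ₗ[R] U) (m : ℕ)
    (i j : I) : Prop where
  braid : wordProd (pseudoReflection x φ) (alternatingWord i j m) =
    wordProd (pseudoReflection x φ) (alternatingWord j i m)
  left : ∀ k, (m ≠ 0 → k < m) → ∃ p ∈ Rpos, ∃ r ∈ Rpos, HasAlternatingCoeffs x φ i j k p r
  right : ∀ k, (m ≠ 0 → k < m) → ∃ p ∈ Rpos, ∃ r ∈ Rpos, HasAlternatingCoeffs x φ j i k p r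

theorem IsPositiveDihedral.symm {Rpos : Subsemiring R} {m : ℕ}
    (h : IsPositiveDihedral Rpos x φ m i j) : IsPositiveDihedral Rpos x φ m j i :=
  ⟨h.braid.symm, h.right, h.left⟩

theorem isPositiveBraidFamily_pseudoReflection {M : CoxeterMatrix I} {Rpos : Subsemiring R}
    (h : ∀ i j, i ≠ j → IsPositiveDihedral Rpos x φ (M i j) i j) {S : Set U}
    (hS : ∀ p ∈ Rpos, ∀ u ∈ S, p • u ∈ S) {K : AddSubmonoid V} (hK : ∀ i, ∀ u ∈ S, x i u ∈ K) :
    IsPositiveBraidFamily M (pseudoReflection x φ) fun T i => ∀ u ∈ S, T (x i u) ∈ K where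
  pos_one := hK
  braid i j := by
    obtain rfl | hij := eq_or_ne i j
    · rfl
    · exact (h i j hij).braid
  pos_mul_alternating i j k hk z hi hj u hu := by
    obtain rfl | hij := eq_or_ne i j
    · obtain rfl : k = 0 := by simpa using hk
      simpa [alternatingWord] using hi u hu
    · obtain ⟨p, hp, r, hr, hpr⟩ := (h i j hij).left k hk
      rw [Module.End.mul_apply, hpr u, ← map_smul, ← map_smul, map_add]
      exact add_mem (hi _ (hS p hp u hu)) (hj _ (hS r hr u hu))

theorem isPositiveDihedral_two (h : IsRealization C x φ) (hij : C i j = 0) (hji : C j i = 0)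
    (Rpos : Subsemiring R) : IsPositiveDihedral Rpos x φ 2 i j := by
  have coeffs {i j : I} (hji : C j i = 0) (k : ℕ) (hk : 2 ≠ 0 → k < 2) :
      ∃ p ∈ Rpos, ∃ r ∈ Rpos, HasAlternatingCoeffs x φ i j k p r := by
    have c₀ := hasAlternatingCoeffs_zero (x := x) (φ := φ) (i := i) (j := j)
    have c₁ := c₀.succ_of_even h (r' := 0) (by decide) (by simp [hji])
    have hk2 := hk two_ne_zero
    interval_cases k
    exacts [⟨1, one_mem _, 0, zero_mem _, c₀⟩, ⟨1, one_mem _, 0, zero_mem _, c₁⟩]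
  refine ⟨?_, coeffs hji, coeffs hij⟩
  ext v
  simp only [alternatingWord, List.concat_eq_append, List.nil_append, List.cons_append,
    wordProd_cons, wordProd_nil, mul_one, Module.End.mul_apply, pseudoReflection_apply, map_sub,
    h i j, h j i, hij, hji, zero_smul, map_zero]
  module

namespace IsQuantumBond

variable {Rpos : Subsemiring R}

theorem symm (hij : IsQuantumBond C t 1 i j) : IsQuantumBond C t 1 j i where
  short := by simpa using hij.long
  long := by simpa using hij.short
  short_long := by simpa using hij.long_short
  long_short := by simpa using hij.short_long

theorem braid_three (hij : IsQuantumBond C t 1 i j) (h : IsRealization C x φ) :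
    wordProd (pseudoReflection x φ) (alternatingWord i j 3) =
      wordProd (pseudoReflection x φ) (alternatingWord j i 3) := by
  ext v
  simp only [alternatingWord, List.concat_eq_append, List.nil_append, List.cons_append,
    wordProd_cons, wordProd_nil, mul_one, Module.End.mul_apply, pseudoReflection_apply, map_sub,
    map_smul, h i i, h i j, h j i, h j j, hij.short, hij.long, hij.short_long,
    hij.long_short, Finset.sum_range_one]
  module

theorem braid_four (hij : IsQuantumBond C t 2 i j) (h : IsRealization C x φ) :
    wordProd (pseudoReflection x φ) (alternatingWord i j 4) =
      wordProd (pseudoReflection x φ) (alternatingWord j i 4) := by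
  ext v
  simp only [alternatingWord, List.concat_eq_append, List.nil_append, List.cons_append,
    wordProd_cons, wordProd_nil, mul_one, Module.End.mul_apply, pseudoReflection_apply, map_sub,
    map_smul, h i i, h i j, h j i, h j j, hij.short, hij.long, hij.short_long,
    hij.long_short, Finset.sum_range_succ, Finset.sum_range_zero]
  module

theorem braid_six (hij : IsQuantumBond C t 3 i j) (h : IsRealization C x φ) :
    wordProd (pseudoReflection x φ) (alternatingWord i j 6) =
      wordProd (pseudoReflection x φ) (alternatingWord j i 6) := by
  ext v
  simp only [alternatingWord, List.concat_eq_append, List.nil_append, List.cons_append,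
    wordProd_cons, wordProd_nil, mul_one, Module.End.mul_apply, pseudoReflection_apply, map_sub,
    map_smul, h i i, h i j, h j i, h j j, hij.short, hij.long, hij.short_long,
    hij.long_short, Finset.sum_range_succ, Finset.sum_range_zero]
  module

theorem exists_coeffs_three (hij : IsQuantumBond C t 1 i j) (h : IsRealization C x φ)
    (ht : t ∈ Rpos) (hk : k < 3) :
    ∃ p ∈ Rpos, ∃ r ∈ Rpos, HasAlternatingCoeffs x φ i j k p r := by
  obtain ⟨hii, _, hij, hji⟩ := hij
  rw [Finset.sum_range_one] at hij
  have c₀ := hasAlternatingCoeffs_zero (x := x) (φ := φ) (i := i) (j := j)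
  have c₁ := c₀.succ_of_even h (r' := t) (by decide) (by grind)
  have c₂ := c₁.succ_of_odd h (p' := 0) (by decide) (by grind)
  interval_cases k
  exacts [⟨_, one_mem _, _, zero_mem _, c₀⟩, ⟨_, one_mem _, _, ht, c₁⟩,
    ⟨_, zero_mem _, _, ht, c₂⟩]

theorem exists_coeffs_four_short (hij : IsQuantumBond C t 2 i j) (h : IsRealization C x φ)
    (ht : t ∈ Rpos) (hk : k < 4) :
    ∃ p ∈ Rpos, ∃ r ∈ Rpos, HasAlternatingCoeffs x φ i j k p r := by
  obtain ⟨hii, hjj, hij, hji⟩ := hij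
  simp only [Finset.sum_range_succ, Finset.sum_range_zero] at hij
  have c₀ := hasAlternatingCoeffs_zero (x := x) (φ := φ) (i := i) (j := j)
  have c₁ := c₀.succ_of_even h (r' := t) (by decide) (by grind)
  have c₂ := c₁.succ_of_odd h (p' := t ^ 4) (by decide) (by grind)
  have c₃ := c₂.succ_of_even h (r' := 0) (by decide) (by grind)
  interval_cases k
  exacts [⟨_, one_mem _, _, zero_mem _, c₀⟩, ⟨_, one_mem _, _, ht, c₁⟩,
    ⟨_, pow_mem ht 4, _, ht, c₂⟩, ⟨_, pow_mem ht 4, _, zero_mem _, c₃⟩]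

theorem exists_coeffs_four_long (hij : IsQuantumBond C t 2 i j) (h : IsRealization C x φ)
    (ht : t ∈ Rpos) (hk : k < 4) :
    ∃ p ∈ Rpos, ∃ r ∈ Rpos, HasAlternatingCoeffs x φ j i k p r := by
  obtain ⟨hii, hjj, hij, hji⟩ := hij
  simp only [Finset.sum_range_succ, Finset.sum_range_zero] at hij
  have c₀ := hasAlternatingCoeffs_zero (x := x) (φ := φ) (i := j) (j := i)
  have c₁ := c₀.succ_of_even h (r' := t + t ^ 3) (by decide) (by grind)
  have c₂ := c₁.succ_of_odd h (p' := t ^ 2) (by decide) (by grind)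
  have c₃ := c₂.succ_of_even h (r' := 0) (by decide) (by grind)
  have hr : t + t ^ 3 ∈ Rpos := add_mem ht (pow_mem ht 3)
  interval_cases k
  exacts [⟨_, one_mem _, _, zero_mem _, c₀⟩, ⟨_, one_mem _, _, hr, c₁⟩,
    ⟨_, pow_mem ht 2, _, hr, c₂⟩, ⟨_, pow_mem ht 2, _, zero_mem _, c₃⟩]

theorem exists_coeffs_six_short (hij : IsQuantumBond C t 3 i j) (h : IsRealization C x φ)
    (ht : t ∈ Rpos) (hk : k < 6) :
    ∃ p ∈ Rpos, ∃ r ∈ Rpos, HasAlternatingCoeffs x φ i j k p r := by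
  obtain ⟨hii, hjj, hij, hji⟩ := hij
  simp only [Finset.sum_range_succ, Finset.sum_range_zero] at hij
  have c₀ := hasAlternatingCoeffs_zero (x := x) (φ := φ) (i := i) (j := j)
  have c₁ := c₀.succ_of_even h (r' := t) (by decide) (by grind)
  have c₂ := c₁.succ_of_odd h (p' := t ^ 4 + t ^ 6) (by decide) (by grind)
  have c₃ := c₂.succ_of_even h (r' := t ^ 5) (by decide) (by grind)
  have c₄ := c₃.succ_of_odd h (p' := t ^ 10) (by decide) (by grind)
  have c₅ := c₄.succ_of_even h (r' := 0) (by decide) (by grind)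
  have hp : t ^ 4 + t ^ 6 ∈ Rpos := add_mem (pow_mem ht 4) (pow_mem ht 6)
  interval_cases k
  exacts [⟨_, one_mem _, _, zero_mem _, c₀⟩, ⟨_, one_mem _, _, ht, c₁⟩, ⟨_, hp, _, ht, c₂⟩,
    ⟨_, hp, _, pow_mem ht 5, c₃⟩, ⟨_, pow_mem ht 10, _, pow_mem ht 5, c₄⟩,
    ⟨_, pow_mem ht 10, _, zero_mem _, c₅⟩]

theorem exists_coeffs_six_long (hij : IsQuantumBond C t 3 i j) (h : IsRealization C x φ)
    (ht : t ∈ Rpos) (hk : k < 6) :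
    ∃ p ∈ Rpos, ∃ r ∈ Rpos, HasAlternatingCoeffs x φ j i k p r := by
  obtain ⟨hii, hjj, hij, hji⟩ := hij
  simp only [Finset.sum_range_succ, Finset.sum_range_zero] at hij
  have c₀ := hasAlternatingCoeffs_zero (x := x) (φ := φ) (i := j) (j := i)
  have c₁ := c₀.succ_of_even h (r' := t + t ^ 3 + t ^ 5) (by decide) (by grind)
  have c₂ := c₁.succ_of_odd h (p' := t ^ 2 + t ^ 4) (by decide) (by grind)
  have c₃ := c₂.succ_of_even h (r' := t ^ 5 + t ^ 7 + t ^ 9) (by decide) (by grind)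
  have c₄ := c₃.succ_of_odd h (p' := t ^ 6) (by decide) (by grind)
  have c₅ := c₄.succ_of_even h (r' := 0) (by decide) (by grind)
  have hp : t ^ 2 + t ^ 4 ∈ Rpos := add_mem (pow_mem ht 2) (pow_mem ht 4)
  have hr : t + t ^ 3 + t ^ 5 ∈ Rpos := add_mem (add_mem ht (pow_mem ht 3)) (pow_mem ht 5)
  have hr' : t ^ 5 + t ^ 7 + t ^ 9 ∈ Rpos :=
    add_mem (add_mem (pow_mem ht 5) (pow_mem ht 7)) (pow_mem ht 9)
  interval_cases k
  exacts [⟨_, one_mem _, _, zero_mem _, c₀⟩, ⟨_, one_mem _, _, hr, c₁⟩, ⟨_, hp, _, hr, c₂⟩,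
    ⟨_, hp, _, hr', c₃⟩, ⟨_, pow_mem ht 6, _, hr', c₄⟩, ⟨_, pow_mem ht 6, _, zero_mem _, c₅⟩]

theorem isPositiveDihedral_three (hij : IsQuantumBond C t 1 i j) (h : IsRealization C x φ)
    (ht : t ∈ Rpos) : IsPositiveDihedral Rpos x φ 3 i j :=
  ⟨hij.braid_three h, fun _ hk => hij.exists_coeffs_three h ht (hk three_ne_zero),
    fun _ hk => hij.symm.exists_coeffs_three h ht (hk three_ne_zero)⟩

theorem isPositiveDihedral_four (hij : IsQuantumBond C t 2 i j) (h : IsRealization C x φ)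
    (ht : t ∈ Rpos) : IsPositiveDihedral Rpos x φ 4 i j :=
  ⟨hij.braid_four h, fun _ hk => hij.exists_coeffs_four_short h ht (hk four_ne_zero),
    fun _ hk => hij.exists_coeffs_four_long h ht (hk four_ne_zero)⟩

theorem isPositiveDihedral_six (hij : IsQuantumBond C t 3 i j) (h : IsRealization C x φ)
    (ht : t ∈ Rpos) : IsPositiveDihedral Rpos x φ 6 i j :=
  ⟨hij.braid_six h, fun _ hk => hij.exists_coeffs_six_short h ht (hk (by decide)),
    fun _ hk => hij.exists_coeffs_six_long h ht (hk (by decide))⟩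

end IsQuantumBond

end PseudoReflections

section QuantumCartan

variable {I R : Type*} [DecidableEq I] [CommRing R]

/-- The Cartan matrix `A` with its entries deformed by `t`, in the normalization in which
`T̃_i` acts on `ℓ`-weights by `v ↦ v - x i (φ i v)` with `φ i (x j) = qCartan A d t i j`. At `t = 1`
it is `A` itself if `A` is of finite type. -/
def qCartan (A : Matrix I I ℤ) (d : I → ℕ) (t : R) : Matrix I I R := fun i j =>
  if i = j then 1 + t ^ (2 * d i)
  else if A i j = -1 then -t ^ d j
  else if A i j = -2 then -(t ^ 3 + t)
  else if A i j = -3 then -(t ^ 5 + t ^ 3 + t)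
  else 0

/-- `A` has the off-diagonal entries of a Cartan matrix of finite type, symmetrized by `d`, and
`d i = 1` for the short root `i` of each multiple bond. -/
structure IsNormalizedFiniteType (A : Matrix I I ℤ) (d : I → ℕ) : Prop where
  off_diagonal : ∀ i j, i ≠ j → (A i j, A j i) ∈
    ({(0, 0), (-1, -1), (-1, -2), (-2, -1), (-1, -3), (-3, -1)} : Set (ℤ × ℤ))
  symm : ∀ i j, (d i : ℤ) * A i j = d j * A j i
  short : ∀ i j, A i j < -1 → d i = 1

/-- The Coxeter matrix of a Cartan matrix of finite type. -/
def coxeterMatrix (A : Matrix I I ℤ) : CoxeterMatrix I where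
  M i j := if i = j then 1 else if A i j * A j i = 0 then 2 else if A i j * A j i = 1 then 3
    else if A i j * A j i = 2 then 4 else 6
  isSymm := Matrix.IsSymm.ext fun i j => by simp only [mul_comm (A j i), eq_comm (a := j)]
  diagonal := by simp
  off_diagonal i j hij := by grind

theorem coxeterMatrix_apply_of_ne (A : Matrix I I ℤ) {i j : I} (hij : i ≠ j) :
    coxeterMatrix A i j = if A i j * A j i = 0 then 2 else if A i j * A j i = 1 then 3
      else if A i j * A j i = 2 then 4 else 6 := if_neg hij

variable {A : Matrix I I ℤ} {d : I → ℕ}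

theorem IsNormalizedFiniteType.qCartan_one (hA : IsNormalizedFiniteType A d)
    (hA2 : ∀ i, A i i = 2) (i j : I) : qCartan A d (1 : R) i j = A i j := by
  obtain rfl | hij := eq_or_ne i j
  · simp [qCartan, hA2, one_add_one_eq_two]
  · obtain h | h | h | h | h | h := hA.off_diagonal i j hij <;>
      obtain ⟨hij', _⟩ := Prod.mk.inj h <;> norm_num [qCartan, hij, hij']

theorem IsNormalizedFiniteType.isQuantumBond (hA : IsNormalizedFiniteType A d) (t : R)
    {i j : I} (hij : i ≠ j) {n : ℕ} (hn : n = 1 ∨ n = 2 ∨ n = 3) (h : A i j = -n)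
    (h' : A j i = -1) :
    IsQuantumBond (qCartan A d t) (t ^ d i) n i j := by
  have hd : d j = n * d i := by
    have := hA.symm i j
    rw [h, h'] at this
    zify
    linarith
  have hd1 : n ≠ 1 → d i = 1 := fun hn1 => hA.short i j (by omega)
  constructor
  · simp [qCartan, pow_mul']
  · rw [qCartan, if_pos rfl, hd]; ring
  · rw [qCartan, if_neg hij, h]
    obtain rfl | rfl | rfl := hn
    · simp [hd]
    · norm_num [hd1, Finset.sum_range_succ, add_comm]
    · norm_num [hd1, Finset.sum_range_succ]
      ring
  · simp [qCartan, hij.symm, h']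

theorem IsNormalizedFiniteType.isPositiveDihedral (hA : IsNormalizedFiniteType A d)
    {U V : Type*} [AddCommGroup U] [Module R U] [AddCommGroup V] [Module R V]
    {x : I → U →ₗ[R] V} {φ : I → V →ₗ[R] U} {t : R} (h : IsRealization (qCartan A d t) x φ)
    {Rpos : Subsemiring R} (ht : t ∈ Rpos) {i j : I} (hij : i ≠ j) :
    IsPositiveDihedral Rpos x φ (coxeterMatrix A i j) i j := by
  rw [coxeterMatrix_apply_of_ne A hij]
  obtain hAij | hAij | hAij | hAij | hAij | hAij := hA.off_diagonal i j hij <;>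
    obtain ⟨hAij, hAji⟩ := Prod.mk.inj hAij
  · simpa [hAij] using isPositiveDihedral_two h (by simp [qCartan, hij, hAij])
      (by simp [qCartan, hij.symm, hAji]) Rpos
  · simpa [hAij, hAji] using
      (hA.isQuantumBond t hij (.inl rfl) hAij hAji).isPositiveDihedral_three h (pow_mem ht _)
  · simpa [hAij, hAji] using ((hA.isQuantumBond t hij.symm (.inr (.inl rfl)) hAji
      hAij).isPositiveDihedral_four h (pow_mem ht _)).symm
  · simpa [hAij, hAji] using (hA.isQuantumBond t hij (.inr (.inl rfl)) hAij
      hAji).isPositiveDihedral_four h (pow_mem ht _)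
  · simpa [hAij, hAji] using ((hA.isQuantumBond t hij.symm (.inr (.inr rfl)) hAji
      hAij).isPositiveDihedral_six h (pow_mem ht _)).symm
  · simpa [hAij, hAji] using (hA.isQuantumBond t hij (.inr (.inr rfl)) hAij
      hAji).isPositiveDihedral_six h (pow_mem ht _)

theorem IsNormalizedFiniteType.isPositiveBraidFamily (hA : IsNormalizedFiniteType A d)
    {U V : Type*} [AddCommGroup U] [Module R U] [AddCommGroup V] [Module R V]
    {x : I → U →ₗ[R] V} {φ : I → V →ₗ[R] U} {t : R} (h : IsRealization (qCartan A d t) x φ)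
    {S : AddSubmonoid U} (hS : ∀ u ∈ S, t • u ∈ S) {K : AddSubmonoid V}
    (hK : ∀ i, ∀ u ∈ S, x i u ∈ K) :
    IsPositiveBraidFamily (coxeterMatrix A) (pseudoReflection x φ)
      fun T i => ∀ u ∈ S, T (x i u) ∈ K := by
  have closure_smul_mem : ∀ p ∈ Subsemiring.closure {t}, ∀ u ∈ S, p • u ∈ S := by
    intro p hp
    induction hp using Subsemiring.closure_induction with
    | mem p hp => exact (Set.mem_singleton_iff.mp hp) ▸ hS
    | zero => simp
    | one => simp
    | add p r _ _ ihp ihr => exact fun u hu => add_smul p r u ▸ add_mem (ihp u hu) (ihr u hu)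
    | mul p r _ _ ihp ihr => exact fun u hu => mul_smul p r u ▸ ihp _ (ihr u hu)
  exact isPositiveBraidFamily_pseudoReflection
    (fun _ _ hij => hA.isPositiveDihedral h (Subsemiring.subset_closure (Set.mem_singleton t)) hij)
    closure_smul_mem hK

end QuantumCartan

section Weyl

variable {ι k M N : Type*} [Field k]
  [AddCommGroup M] [Module k M] [AddCommGroup N] [Module k N] {P : RootPairing ι k M N}

theorem weylGroupRootRep_injective : Function.Injective P.weylGroupRootRep := by
  intro g h hgh
  apply Subtype.ext
  apply RootPairing.Equiv.weightHom_injective P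
  ext v
  exact LinearMap.congr_fun hgh v

theorem weylGroupRootRep_ofIdx_apply (i : ι) (v : M) :
    P.weylGroupRootRep (RootPairing.weylGroup.ofIdx P i) v = v - P.coroot' i v • P.root i :=
  P.reflection_apply i v

theorem coroot'_weylGroupRootRep_apply {g : P.weylGroup} {i j : ι}
    (h : P.weylGroupRootRep g (P.root j) = P.root i) (v : M) :
    P.coroot' i (P.weylGroupRootRep g v) = P.coroot' j v := by
  have hidx : g.1.indexEquiv j = i :=
    P.root.injective ((RootPairing.Hom.root_weightMap_apply _ _ _ _).symm.trans h)
  have hcoroot := RootPairing.Hom.coroot_coweightMap_apply P P i g.1.toHom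
  rw [← hidx, Equiv.symm_apply_apply, hidx] at hcoroot
  have htranspose := RootPairing.Hom.weight_coweight_transpose_apply P P (P.coroot i) g.1.toHom
  rw [hcoroot] at htranspose
  exact LinearMap.congr_fun htranspose v

theorem ofIdx_mul_eq_mul_ofIdx {g : P.weylGroup} {i j : ι}
    (h : P.weylGroupRootRep g (P.root j) = P.root i) :
    RootPairing.weylGroup.ofIdx P i * g = g * RootPairing.weylGroup.ofIdx P j := by
  apply weylGroupRootRep_injective
  ext v
  rw [map_mul, map_mul, Module.End.mul_apply, Module.End.mul_apply, weylGroupRootRep_ofIdx_apply,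
    weylGroupRootRep_ofIdx_apply, map_sub, map_smul, coroot'_weylGroupRootRep_apply h, h]

theorem wordProd_ofIdx (b : P.Base) (l : List b.support) :
    wordProd (fun i : b.support => RootPairing.weylGroup.ofIdx P (i : ι)) l = weylWord b l := by
  -- The coercion in `weylWord` elaborates to a lift of `l` to `List ι` in the list monad.
  simp [wordProd, weylWord]

theorem IsReducedExpr.isReducedWord {b : P.Base} {w : P.weylGroup} {l : List b.support}
    (h : IsReducedExpr b w l) :
    IsReducedWord (fun i : b.support => RootPairing.weylGroup.ofIdx P (i : ι)) l := by
  intro l' hl'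
  rw [wordProd_ofIdx, wordProd_ofIdx, h.1] at hl'
  exact h.2 l' hl'

variable [CharZero k]

theorem isPos_of_root_mem_closure (b : P.Base) {i : ι}
    (h : P.root i ∈ AddSubmonoid.closure (P.root '' b.support)) : b.IsPos i := by
  obtain ⟨f, hf⟩ : ∃ f : ι → ℕ, P.root i = ∑ j ∈ b.support, f j • P.root j := by
    classical
    generalize P.root i = m at h
    induction h using AddSubmonoid.closure_induction with
    | mem m hm =>
      obtain ⟨j, hj, rfl⟩ := hm
      exact ⟨Pi.single j 1, by simp [Pi.single_apply, Finset.mem_coe.mp hj]⟩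
    | zero => exact ⟨0, by simp⟩
    | add _ _ _ _ hf hg =>
      obtain ⟨⟨f, hf⟩, g, hg⟩ := And.intro hf hg
      exact ⟨f + g, by simp [hf, hg, add_smul, Finset.sum_add_distrib]⟩
  rw [b.isPos_iff', RootPairing.Base.height_eq_sum (f := fun j => (f j : ℤ)) (by simpa using hf)]
  exact Finset.sum_nonneg fun _ _ => Int.natCast_nonneg _

theorem root_mem_closure_iff (b : P.Base) {i : ι} :
    P.root i ∈ AddSubmonoid.closure (P.root '' b.support) ↔ b.IsPos i := by
  let := P.indexNeg
  refine ⟨isPos_of_root_mem_closure b, fun h => ?_⟩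
  refine (b.root_mem_or_neg_mem i).resolve_right fun hneg => ?_
  have : b.IsPos (-i) := isPos_of_root_mem_closure b (by simpa using hneg)
  exact (RootPairing.Base.IsPos.neg_iff_not b i).mp this h

theorem neg_root_mem_closure_iff (b : P.Base) (i : ι) :
    -P.root i ∈ AddSubmonoid.closure (P.root '' b.support) ↔
      P.root i ∉ AddSubmonoid.closure (P.root '' b.support) := by
  let := P.indexNeg
  simpa [← root_mem_closure_iff] using RootPairing.Base.IsPos.neg_iff_not b i

variable [P.IsCrystallographic]

theorem isRealization_root_coroot {b : P.Base} {d : b.support → ℕ} [DecidableEq b.support]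
    (hd : IsNormalizedFiniteType (cartan b) d) :
    IsRealization (qCartan (cartan b) d (1 : k))
      (fun i => LinearMap.toSpanSingleton k M (P.root i)) (fun i => P.coroot' (i : ι)) := by
  intro i j u
  have hcartan : P.pairing j i = cartan b i j := (P.algebraMap_pairingIn ℤ j i).symm
  simp [hd.qCartan_one (fun i => b.cartanMatrix_apply_same i), ← hcartan, mul_comm]

theorem isPositiveBraidFamily_weylGroup {b : P.Base} {d : b.support → ℕ} [DecidableEq b.support]
    (hd : IsNormalizedFiniteType (cartan b) d) :
    IsPositiveBraidFamily (coxeterMatrix (cartan b))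
      (fun i : b.support => RootPairing.weylGroup.ofIdx P (i : ι))
      fun g i => P.weylGroupRootRep g (P.root i) ∈ AddSubmonoid.closure (P.root '' b.support) := by
  have hmultiples (T : Module.End k M) (i : b.support) :
      (∀ u ∈ AddSubmonoid.multiples (1 : k), T (LinearMap.toSpanSingleton k M (P.root i) u) ∈
        AddSubmonoid.closure (P.root '' b.support)) ↔
      T (P.root i) ∈ AddSubmonoid.closure (P.root '' b.support) := by
    refine ⟨fun h => by simpa using h 1 (AddSubmonoid.mem_multiples 1), ?_⟩
    rintro hT _ ⟨n, rfl⟩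
    simpa [Nat.cast_smul_eq_nsmul] using AddSubmonoid.nsmul_mem _ hT n
  have hcomp : pseudoReflection (fun i : b.support => LinearMap.toSpanSingleton k M (P.root i))
      (fun i => P.coroot' (i : ι)) =
        (P.weylGroupRootRep : P.weylGroup →* Module.End k M) ∘
          fun i : b.support => RootPairing.weylGroup.ofIdx P (i : ι) := by
    ext i v
    simp [pseudoReflection_apply, weylGroupRootRep_ofIdx_apply]
  have h := hd.isPositiveBraidFamily (isRealization_root_coroot hd)
    (S := AddSubmonoid.multiples (1 : k)) (fun u hu => by simpa using hu)
    (K := AddSubmonoid.closure (P.root '' b.support))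
    fun i => (hmultiples 1 i).mpr (AddSubmonoid.subset_closure (Set.mem_image_of_mem _ i.2))
  simp only [hcomp, hmultiples] at h
  exact h.of_injective weylGroupRootRep_injective

variable [Finite ι] [P.IsReduced]

theorem cartan_mem (b : P.Base) {i j : b.support} (hij : i ≠ j) :
    (cartan b i j, cartan b j i) ∈
      ({(0, 0), (-1, -1), (-1, -2), (-2, -1), (-1, -3), (-3, -1)} : Set (ℤ × ℤ)) := by
  have : Module.IsReflexive k M := .of_isPerfPair P.toLinearMap
  have hne : (j : ι) ≠ i := fun h => hij (Subtype.ext h.symm)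
  have hmem := P.pairingIn_pairingIn_mem_set_of_isCrystal_of_isRed' (i := j) (j := i)
    (by simpa using hne) (b.root_ne_neg_of_ne j.2 i.2 hne)
  have hle : P.pairingIn ℤ j i ≤ 0 := b.cartanMatrix_le_zero_of_ne j i hij.symm
  change (P.pairingIn ℤ j i, P.pairingIn ℤ i j) ∈ _
  generalize P.pairingIn ℤ j i = x at *
  generalize P.pairingIn ℤ i j = y at *
  simp only [Set.mem_insert_iff, Set.mem_singleton_iff, Prod.mk.injEq] at hmem ⊢
  omega

theorem isReflectionSystem_weylGroup {b : P.Base} {d : b.support → ℕ} [DecidableEq b.support]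
    (hd : IsNormalizedFiniteType (cartan b) d) :
    IsReflectionSystem (coxeterMatrix (cartan b))
      (fun i : b.support => RootPairing.weylGroup.ofIdx P (i : ι))
      fun g i => P.weylGroupRootRep g (P.root i) ∈ AddSubmonoid.closure (P.root '' b.support) where
  toIsPositiveBraidFamily := isPositiveBraidFamily_weylGroup hd
  mul_self i := by
    apply weylGroupRootRep_injective
    ext v
    exact P.reflection_same i v
  pos_mul_iff g i := by
    have hneg : P.weylGroupRootRep (RootPairing.weylGroup.ofIdx P (i : ι)) (P.root i) =
        -P.root i := P.reflection_apply_self i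
    rw [map_mul, Module.End.mul_apply, hneg, map_neg,
      show P.weylGroupRootRep g (P.root i) = _ from P.weylGroup_apply_root g i,
      neg_root_mem_closure_iff]
  exchange g i j hpos hneg := by
    obtain ⟨l, hl⟩ : ∃ l, P.weylGroupRootRep g (P.root j) = P.root l :=
      ⟨_, P.weylGroup_apply_root g j⟩
    have hrefl : P.weylGroupRootRep (RootPairing.weylGroup.ofIdx P (i : ι)) (P.root l) =
        P.root (P.reflectionPerm i l) := (P.root_reflectionPerm i l).symm
    rw [map_mul, Module.End.mul_apply, hl, hrefl, root_mem_closure_iff] at hneg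
    rw [hl, root_mem_closure_iff] at hpos
    have hli : l = i := by
      by_contra hne
      exact hneg (hpos.reflectionPerm i.2 hne)
    exact ofIdx_mul_eq_mul_ofIdx (hli ▸ hl)

theorem symmetrizer_proportional [P.IsIrreducible] (b : P.Base) (d : b.support → ℕ)
    (hd : ∀ i j, (d i : ℤ) * cartan b i j = (d j : ℤ) * cartan b j i) (B : P.InvariantForm)
    (i j : b.support) :
    (d i : k) * B.form (P.root j) (P.root j) = d j * B.form (P.root i) (P.root i) := by
  refine b.induction_on_cartanMatrix (i := i) (j := j)
    (fun j => (d i : k) * B.form (P.root j) (P.root j) = d j * B.form (P.root i) (P.root i))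
    rfl ?_
  intro l m hl hml
  have hsymm : (d l : k) * P.pairing m l = d m * P.pairing l m := by
    rw [← P.algebraMap_pairingIn ℤ m l, ← P.algebraMap_pairingIn ℤ l m, eq_intCast, eq_intCast]
    exact_mod_cast hd l m
  have hswap := B.pairing_mul_eq_pairing_mul_swap l m
  have hlm : P.pairing l m ≠ 0 := by
    rwa [ne_eq, ← b.cartanMatrix_apply_eq_zero_iff_pairing,
      b.cartanMatrix_apply_eq_zero_iff_symm]
  apply mul_left_cancel₀ hlm
  linear_combination (-(d i : k)) * hswap + P.pairing m l * hl +
    B.form (P.root i) (P.root i) * hsymm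

theorem symmetrizer_eq_iff [P.IsIrreducible] (b : P.Base) {d : b.support → ℕ}
    (hd_pos : ∀ i, 0 < d i)
    (hd : ∀ i j, (d i : ℤ) * cartan b i j = (d j : ℤ) * cartan b j i) (B : P.InvariantForm)
    (i j : b.support) :
    d i = d j ↔ B.form (P.root i) (P.root i) = B.form (P.root j) (P.root j) := by
  have hprop := symmetrizer_proportional b d hd B i j
  have hdi : (d i : k) ≠ 0 := by exact_mod_cast (hd_pos i).ne'
  constructor <;> intro h
  · rw [← h] at hprop
    exact (mul_left_cancel₀ hdi hprop).symm
  · rw [h] at hprop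
    exact_mod_cast mul_right_cancel₀ (B.ne_zero j) hprop

theorem symmetrizer_eq_one_of_cartan_lt [P.IsIrreducible] (b : P.Base) {d : b.support → ℕ}
    (hd_pos : ∀ i, 0 < d i)
    (hd : ∀ i j, (d i : ℤ) * cartan b i j = (d j : ℤ) * cartan b j i)
    (hd_coprime : ∀ m : ℕ, (∀ i, m ∣ d i) → m = 1) {i j : b.support}
    (h : cartan b i j < -1) : d i = 1 := by
  have : Fintype ι := Fintype.ofFinite ι
  let B := (P.posRootForm ℤ).toInvariantForm
  have hii : cartan b i i = 2 := b.cartanMatrix_apply_same i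
  have hij : i ≠ j := by
    rintro rfl
    omega
  have hji : cartan b j i = -1 := by
    have := cartan_mem b hij
    simp only [Set.mem_insert_iff, Set.mem_singleton_iff, Prod.mk.injEq] at this
    omega
  have hdj : (d j : ℤ) = d i * -cartan b i j := by linear_combination hd i j + d j * hji
  have hne : d i ≠ d j := by
    intro heq
    have := hd_pos i
    nlinarith
  have hdvd : d i ∣ d j := Int.natCast_dvd_natCast.mp ⟨_, hdj⟩
  have hlength := symmetrizer_eq_iff b hd_pos hd B
  refine hd_coprime _ fun l => ?_
  rcases B.apply_eq_or_of_apply_ne (fun h => hne ((hlength i j).mpr h)) l with hl | hl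
  · exact ((hlength l i).mpr hl).symm.dvd
  · exact ((hlength l j).mpr hl) ▸ hdvd

end Weyl

section Subst

theorem coe_subst (c : ℂˣ) (f : unitaryRatFunc) :
    ((subst c f : (RatFunc ℂ)ˣ) : RatFunc ℂ) = substRatFunc c ((f : (RatFunc ℂ)ˣ) : RatFunc ℂ) :=
  rfl

theorem subst_subst (c e : ℂˣ) (f : unitaryRatFunc) :
    subst c (subst e f) = subst (c * e) f := by
  obtain ⟨f, p, r, hp, hr, hf⟩ := f
  apply Subtype.ext
  apply Units.ext
  have hcomp (p : ℂ[X]) : (p.comp (C (e : ℂ) * X)).comp (C (c : ℂ) * X) =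
      p.comp (C ((c * e : ℂˣ) : ℂ) * X) := by
    simp [comp_assoc, mul_left_comm, ← mul_assoc]
  simp only [coe_subst, hf, map_div₀, substRatFunc_algebraMap, hcomp]

theorem subst_one (f : unitaryRatFunc) : subst 1 f = f := by
  obtain ⟨f, p, r, hp, hr, hf⟩ := f
  apply Subtype.ext
  apply Units.ext
  simp [coe_subst, hf, substRatFunc_algebraMap]

theorem subst_oneSub (c a : ℂˣ) : subst c (oneSub a) = oneSub (c * a) := by
  apply Subtype.ext
  apply Units.ext
  change substRatFunc c (algebraMap ℂ[X] (RatFunc ℂ) (1 - C (a : ℂ) * X)) =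
    algebraMap ℂ[X] (RatFunc ℂ) (1 - C ((c * a : ℂˣ) : ℂ) * X)
  rw [substRatFunc_algebraMap]
  congr 1
  simp only [sub_comp, one_comp, mul_comp, C_comp, X_comp, Units.val_mul, C_mul]
  ring

/-- The action of `ℂˣ` by `c ↦ subst c` on the additively written group of quotients of polynomials
with constant term one. -/
def substRep : Representation ℤ ℂˣ (Additive unitaryRatFunc) where
  toFun c := (MonoidHom.toAdditive (subst c)).toIntLinearMap
  map_one' := LinearMap.ext fun f => congrArg Additive.ofMul (subst_one f.toMul)
  map_mul' c e := LinearMap.ext fun f =>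
    congrArg Additive.ofMul (subst_subst c e f.toMul).symm

/-- The group of quotients of polynomials with constant term one, written additively, as a module
over the group ring of `ℂˣ`. -/
abbrev SubstModule : Type := substRep.asModule

/-- The class of `f` in `SubstModule`. -/
def toSubst (f : unitaryRatFunc) : SubstModule := substRep.asModuleEquiv.symm (Additive.ofMul f)

theorem toSubst_subst (c : ℂˣ) (f : unitaryRatFunc) :
    toSubst (subst c f) = MonoidAlgebra.of ℤ ℂˣ c • toSubst f :=
  substRep.asModuleEquiv_symm_map_rho c (Additive.ofMul f)

theorem toSubst_one : toSubst 1 = 0 := rfl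
theorem toSubst_mul (f g : unitaryRatFunc) : toSubst (f * g) = toSubst f + toSubst g := rfl
theorem toSubst_inv (f : unitaryRatFunc) : toSubst f⁻¹ = -toSubst f := rfl

end Subst

section LWeight

variable {I : Type*} (A : Matrix I I ℤ) (d : I → ℕ) (q : ℂˣ)

/-- The `ℓ`-weight lattice, written additively, as a module over the group ring of `ℂˣ`. -/
def lWeightAddEquiv (I : Type*) : Additive (LWeight I) ≃+ (I → SubstModule) where
  toFun ϖ i := toSubst (ϖ.toMul i)
  invFun v := Additive.ofMul fun i => (substRep.asModuleEquiv (v i)).toMul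
  left_inv _ := rfl
  right_inv _ := rfl
  map_add' _ _ := rfl

theorem lWeightAddEquiv_apply (ϖ : LWeight I) (i : I) :
    lWeightAddEquiv I (Additive.ofMul ϖ) i = toSubst (ϖ i) := rfl

variable [DecidableEq I]

/-- The map `u ↦ (C_{ji} u)_j` given by the `i`-th column of the quantum Cartan matrix `C`; it sends
`1 - a u` to the `ℓ`-root `α_{i,a}`. -/
def qCartanColumn (i : I) : SubstModule →ₗ[MonoidAlgebra ℤ ℂˣ] I → SubstModule :=
  LinearMap.pi fun j => qCartan A d (MonoidAlgebra.of ℤ ℂˣ q) j i • LinearMap.id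

theorem qCartanColumn_apply (i j : I) (u : SubstModule) :
    qCartanColumn A d q i u j = qCartan A d (MonoidAlgebra.of ℤ ℂˣ q) j i • u := rfl

theorem isRealization_qCartanColumn :
    IsRealization (qCartan A d (MonoidAlgebra.of ℤ ℂˣ q)) (qCartanColumn A d q) LinearMap.proj :=
  fun i j u => qCartanColumn_apply A d q j i u

theorem toSubst_bondFactor {i j : I} (hij : i ≠ j) (f : unitaryRatFunc) :
    toSubst (bondFactor q (q ^ d j) (A i j) f) =
      -(qCartan A d (MonoidAlgebra.of ℤ ℂˣ q) i j • toSubst f) := by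
  unfold bondFactor qCartan
  split_ifs <;>
    simp only [MonoidHom.mul_apply, MonoidHom.one_apply, toSubst_mul, toSubst_one, toSubst_subst,
      map_pow, neg_smul, add_smul, neg_neg, zero_smul, neg_zero]

theorem lWeightAddEquiv_braidOp (i : I) (ϖ : LWeight I) :
    lWeightAddEquiv I (Additive.ofMul (braidOp A d q i ϖ)) =
      pseudoReflection (qCartanColumn A d q) LinearMap.proj i
        (lWeightAddEquiv I (Additive.ofMul ϖ)) := by
  funext j
  rw [pseudoReflection_apply, Pi.sub_apply, qCartanColumn_apply, LinearMap.proj_apply]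
  simp only [lWeightAddEquiv_apply]
  obtain rfl | hij := eq_or_ne j i
  · have hbraid : braidOp A d q j ϖ j = (subst ((q ^ d j) ^ 2) (ϖ j))⁻¹ := if_pos rfl
    rw [hbraid, toSubst_inv, toSubst_subst, qCartan, if_pos rfl, ← pow_mul', map_pow]
    module
  · have hbraid : braidOp A d q i ϖ j = ϖ j * bondFactor q (q ^ d i) (A j i) (ϖ i) := if_neg hij
    rw [hbraid, toSubst_mul, toSubst_bondFactor A d q hij, sub_eq_add_neg]

theorem lWeightAddEquiv_braidWordOp (l : List I) (ϖ : LWeight I) :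
    lWeightAddEquiv I (Additive.ofMul (braidWordOp A d q l ϖ)) =
      wordProd (pseudoReflection (qCartanColumn A d q) LinearMap.proj) l
        (lWeightAddEquiv I (Additive.ofMul ϖ)) := by
  induction l with
  | nil => rfl
  | cons i l ih =>
    rw [braidWordOp_cons_apply, lWeightAddEquiv_braidOp, ih, wordProd_cons, Module.End.mul_apply]

theorem lWeightAddEquiv_lRoot (i : I) (a : ℂˣ) :
    lWeightAddEquiv I (Additive.ofMul (lRoot A d q i a)) =
      qCartanColumn A d q i (toSubst (oneSub a)) := by
  have hfund : lWeightAddEquiv I (Additive.ofMul (fundWeight i a)) i = toSubst (oneSub a) := by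
    rw [lWeightAddEquiv_apply, fundWeight, Pi.mulSingle_eq_same]
  rw [lRoot, ofMul_mul, ofMul_inv, map_add, map_neg, lWeightAddEquiv_braidOp,
    pseudoReflection_apply, neg_sub, sub_add_cancel, LinearMap.proj_apply, hfund]

theorem smul_mem_closure_oneSub {u : SubstModule}
    (hu : u ∈ AddSubmonoid.closure (Set.range fun a => toSubst (oneSub a))) :
    MonoidAlgebra.of ℤ ℂˣ q • u ∈
      AddSubmonoid.closure (Set.range fun a => toSubst (oneSub a)) := by
  induction hu using AddSubmonoid.closure_induction with
  | mem u hu =>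
    obtain ⟨a, rfl⟩ := hu
    rw [← toSubst_subst, subst_oneSub]
    exact AddSubmonoid.subset_closure ⟨q * a, rfl⟩
  | zero => simp
  | add u v _ _ hu hv => exact smul_add (MonoidAlgebra.of ℤ ℂˣ q) u v ▸ add_mem hu hv

theorem qCartanColumn_mem_map_lRootMonoid (i : I) {u : SubstModule}
    (hu : u ∈ AddSubmonoid.closure (Set.range fun a => toSubst (oneSub a))) :
    qCartanColumn A d q i u ∈
      (Submonoid.toAddSubmonoid (lRootMonoid A d q)).map (lWeightAddEquiv I) := by
  induction hu using AddSubmonoid.closure_induction with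
  | mem u hu =>
    obtain ⟨a, rfl⟩ := hu
    have hmem : lRoot A d q i a ∈ lRootMonoid A d q := Submonoid.subset_closure ⟨i, a, rfl⟩
    exact ⟨_, hmem, lWeightAddEquiv_lRoot A d q i a⟩
  | zero => simp
  | add u v _ _ hu hv => exact map_add (qCartanColumn A d q i) u v ▸ add_mem hu hv

variable {A d}

theorem IsReflectionSystem.braidWordOp_lRoot_mem {G : Type*} [Group G] {s : I → G}
    {P : G → I → Prop} (hs : IsReflectionSystem (coxeterMatrix A) s P)
    (hA : IsNormalizedFiniteType A d) {l : List I} (hl : IsReducedWord s l) {i : I}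
    (hi : P (wordProd s l) i) (a : ℂˣ) :
    braidWordOp A d q l (lRoot A d q i a) ∈ lRootMonoid A d q := by
  have hfamily := hA.isPositiveBraidFamily (isRealization_qCartanColumn A d q)
    (fun _ => smul_mem_closure_oneSub q) fun i _ => qCartanColumn_mem_map_lRootMonoid A d q i
  have hmem := hs.pos_of_isReducedWord hfamily hl hi _ (AddSubmonoid.subset_closure ⟨a, rfl⟩)
  rw [← lWeightAddEquiv_lRoot, ← lWeightAddEquiv_braidWordOp] at hmem
  exact (AddSubmonoid.mem_map_iff_mem (lWeightAddEquiv I).injective).mp hmem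

end LWeight

end EllRoot

end

theorem mainTheorem1_general {ι k M N : Type*} [Finite ι] [DecidableEq ι] [Field k] [CharZero k]
    [AddCommGroup M] [Module k M] [AddCommGroup N] [Module k N]
    (P : RootPairing ι k M N) [P.IsCrystallographic] [P.IsReduced] (b : P.Base)
    (d : b.support → ℕ)
    (hd_symm : ∀ i j, (d i : ℤ) * EllRoot.cartan b i j = (d j : ℤ) * EllRoot.cartan b j i)
    (hd_short : ∀ i j, EllRoot.cartan b i j < -1 → d i = 1)
    (q : ℂˣ) (w : P.weylGroup) (i : b.support) (hw : w • P.root i ∈ EllRoot.positiveRoots b)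
    (l : List b.support) (hl : EllRoot.IsReducedExpr b w l) (a : ℂˣ) :
    EllRoot.braidWordOp (EllRoot.cartan b) d q l (EllRoot.lRoot (EllRoot.cartan b) d q i a) ∈
      EllRoot.lRootMonoid (EllRoot.cartan b) d q := by
  have hA : EllRoot.IsNormalizedFiniteType (EllRoot.cartan b) d :=
    ⟨fun _ _ => EllRoot.cartan_mem b, hd_symm, hd_short⟩
  refine (EllRoot.isReflectionSystem_weylGroup hA).braidWordOp_lRoot_mem q hA hl.isReducedWord ?_ a
  rw [EllRoot.wordProd_ofIdx, hl.1]
  exact hw.2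

theorem mainTheorem1 {ι k M N : Type*} [Finite ι] [DecidableEq ι] [Field k] [CharZero k]
    [AddCommGroup M] [Module k M] [AddCommGroup N] [Module k N]
    (P : RootPairing ι k M N) [P.IsRootSystem] [P.IsCrystallographic] [P.IsReduced]
    [P.IsIrreducible] (b : P.Base)
    (d : b.support → ℕ) (hd_pos : ∀ i, 0 < d i)
    (hd_symm : ∀ i j, (d i : ℤ) * EllRoot.cartan b i j = (d j : ℤ) * EllRoot.cartan b j i)
    (hd_coprime : ∀ m : ℕ, (∀ i, m ∣ d i) → m = 1)
    (q : ℂˣ) (hq : ∀ m : ℕ, 0 < m → q ^ m ≠ 1)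
    (w : P.weylGroup) (i : b.support) (hw : w • P.root i ∈ EllRoot.positiveRoots b)
    (l : List b.support) (hl : EllRoot.IsReducedExpr b w l) (a : ℂˣ) :
    EllRoot.braidWordOp (EllRoot.cartan b) d q l (EllRoot.lRoot (EllRoot.cartan b) d q i a) ∈
      EllRoot.lRootMonoid (EllRoot.cartan b) d q := by
  have hd_short (i j) : EllRoot.cartan b i j < -1 → d i = 1 :=
    EllRoot.symmetrizer_eq_one_of_cartan_lt b hd_pos hd_symm hd_coprime
  exact mainTheorem1_general P b d hd_symm hd_short q w i hw l hl a
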